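/- Let $R$ be a Noetherian local domain with quotient field $K$. A filtration $\mathcal I=\{I_n\}_{n\ge 0}$ on a ring is a descending chain of ideals with $I_0$ the whole ring and $I_iI_j\subseteq I_{i+j}$ for all $i,j$. The analytic spread of a filtration $\mathcal I$ on a local ring $(A,m_A)$ is the Krull dimension $$\ell(\mathcal I)=\dim A[\mathcal I]/m_AA[\mathcal I],\qquad A[\mathcal I]=\sum_{n\ge 0}I_nt^n\subseteq A[t].$$ For a prime ideal $Q$ of $R$, $\mathcal I_Q$ denotes the filtration $\{I_nR_Q\}$ of $R_Q$. A divisorial valuation of $R$ is a valuation $\nu$ of $K$ whose valuation ring $\mathcal O_\nu$, with maximal ideal $m_\nu$ and residue field $\kappa(\nu)$, contains $R$ and satisfies $\operatorname{trdeg}_{\kappa(\mathfrak p)}\kappa(\nu)=\operatorname{ht}(\mathfrak p)-1$, where $\mathfrak p=m_\nu\cap R$ and $\kappa(\mathfrak p)$ is the residue field of $R_{\mathfrak p}$. It is an $s$-valuation if moreover $\dim R/\mathfrak p=s$. Put $I(\nu)_n=m_\nu^n\cap R$ for $n\ge 0$. A filtration $\mathcal I=\{I_m\}$ on $R$ is $s$-divisorial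 ($s\in\mathbb N$) if there are $s$-valuations $\nu_1,\dots,\nu_r$ and integers $a_1,\dots,a_r\ge 0$ such that $I_m=I(\nu_1)_{ma_1}\cap\cdots\cap I(\nu_r)_{ma_r}$ for all $m\ge 0$. Let $\mathcal I=\{I_n\}$ be an $s$-divisorial filtration on $R$, and let $Q$ be a prime ideal of $R$ which is not a minimal prime of $I_1$ and such that $I_1\subseteq Q$ or $\dim R_Q\ge 2$. Then $$\ell(\mathcal I_Q)<\dim R_Q .$$ -/

import Mathlib

open scoped Polynomial

/-- A filtration of ideals `R = I₀ ⊇ I₁ ⊇ I₂ ⊇ ⋯` on a ring `R`, with `Iᵢ Iⱼ ⊆ Iᵢ₊ⱼ`. -/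
structure IdealFiltration (R : Type*) [CommRing R] where
  /-- The ideals of the filtration. -/
  ideal : ℕ → Ideal R
  ideal_zero : ideal 0 = ⊤
  antitone_ideal : Antitone ideal
  mul_le : ∀ i j, ideal i * ideal j ≤ ideal (i + j)

namespace IdealFiltration

/-- The Rees ring `R[𝓘] = ∑ Iₙ tⁿ`, as a subalgebra of the polynomial ring `R[t]`. -/
def rees {R : Type*} [CommRing R] (F : IdealFiltration R) : Subalgebra R R[X] where
  carrier := { f | ∀ i, f.coeff i ∈ F.ideal i }
  mul_mem' hf hg i := by
    rw [Polynomial.coeff_mul]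
    apply Ideal.sum_mem
    rintro ⟨j, k⟩ e
    rw [← Finset.HasAntidiagonal.mem_antidiagonal.mp e]
    exact F.mul_le j k (Ideal.mul_mem_mul (hf j) (hg k))
  add_mem' hf hg i := by
    rw [Polynomial.coeff_add]
    exact Ideal.add_mem _ (hf i) (hg i)
  algebraMap_mem' r i := by
    rw [Polynomial.algebraMap_apply, Polynomial.coeff_C]
    split_ifs with h
    · subst h
      simp [F.ideal_zero]
    · simp

/-- The analytic spread `ℓ(𝓘) = dim R[𝓘] / m_R R[𝓘]` of a filtration on a local ring `R`. -/
noncomputable def analyticSpread {R : Type*} [CommRing R] [IsLocalRing R]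
    (F : IdealFiltration R) : WithBot ℕ∞ :=
  ringKrullDim (F.rees ⧸ (IsLocalRing.maximalIdeal R).map (algebraMap R F.rees))

/-- The localization `𝓘_Q = {Iₙ R_Q}` of a filtration at a prime ideal `Q`. -/
def localize {R : Type*} [CommRing R] (F : IdealFiltration R) (Q : Ideal R) [Q.IsPrime] :
    IdealFiltration (Localization.AtPrime Q) where
  ideal n := (F.ideal n).map (algebraMap R (Localization.AtPrime Q))
  ideal_zero := by rw [F.ideal_zero, Ideal.map_top]
  antitone_ideal _ _ h := Ideal.map_mono (F.antitone_ideal h)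
  mul_le i j := by
    rw [← Ideal.map_mul]
    exact Ideal.map_mono (F.mul_le i j)

end IdealFiltration

/-- A valuation of the field `K` that is nonnegative on `R`, given (up to equivalence) by its
valuation ring `𝒪_ν`, a valuation ring of `K` which contains the image of `R`. -/
structure ValuationOver (R K : Type*) [CommRing R] [Field K] [Algebra R K] where
  /-- The valuation ring `𝒪_ν`. -/
  ring : ValuationSubring K
  algebraMap_mem : ∀ x : R, algebraMap R K x ∈ ring

namespace ValuationOver

variable {R K : Type*} [CommRing R] [Field K] [Algebra R K]

/-- The inclusion `R → 𝒪_ν`. -/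
def toRing (ν : ValuationOver R K) : R →+* ν.ring :=
  (algebraMap R K).codRestrict ν.ring.toSubring ν.algebraMap_mem

/-- The center `𝔭 = m_ν ∩ R` of `ν` on `R`. -/
def center (ν : ValuationOver R K) : Ideal R :=
  (IsLocalRing.maximalIdeal ν.ring).comap ν.toRing

instance (ν : ValuationOver R K) : ν.center.IsPrime :=
  inferInstanceAs ((IsLocalRing.maximalIdeal ν.ring).comap ν.toRing).IsPrime

/-- The valuation ideal `I(ν)ₙ = m_νⁿ ∩ R` (that is, `{f ∈ R | ν(f) ≥ n}` for a discrete
valuation `ν` with value group `ℤ`). -/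
def valuationIdeal (ν : ValuationOver R K) (n : ℕ) : Ideal R :=
  (IsLocalRing.maximalIdeal ν.ring ^ n).comap ν.toRing

/-- The inclusion `κ(𝔭) → κ(ν)` of residue fields, where `𝔭` is the center of `ν` on `R`. -/
noncomputable def residueMap (ν : ValuationOver R K) :
    ν.center.ResidueField →+* IsLocalRing.ResidueField ν.ring :=
  Ideal.ResidueField.lift ν.center ((IsLocalRing.residue ν.ring).comp ν.toRing)
    (fun x hx => by
      rw [RingHom.mem_ker, RingHom.comp_apply, IsLocalRing.residue_eq_zero_iff]
      exact hx)
    (fun x hx => by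
      rw [Submonoid.mem_comap, IsUnit.mem_submonoid_iff, RingHom.comp_apply, isUnit_iff_ne_zero,
        Ne, IsLocalRing.residue_eq_zero_iff]
      exact hx)

/-- The transcendence degree of `κ(ν)` over `κ(𝔭)`, where `𝔭` is the center of `ν` on `R`. -/
noncomputable def residueTrdeg (ν : ValuationOver R K) : Cardinal :=
  letI := ν.residueMap.toAlgebra
  Algebra.trdeg ν.center.ResidueField (IsLocalRing.ResidueField ν.ring)

/-- `ν` is a divisorial valuation of `R`: `trdeg_{κ(𝔭)} κ(ν) = ht 𝔭 - 1` for its center `𝔭`. -/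
def IsDivisorial (ν : ValuationOver R K) : Prop :=
  Cardinal.toENat ν.residueTrdeg + 1 = ν.center.height

/-- `ν` is an `s`-valuation of `R`: it is divisorial and `dim R / 𝔭 = s` for its center `𝔭`. -/
def IsSValuation (ν : ValuationOver R K) (s : ℕ) : Prop :=
  ν.IsDivisorial ∧ ringKrullDim (R ⧸ ν.center) = s

end ValuationOver

/-- `𝓘` is an (integral) `s`-divisorial filtration of the domain `R` with quotient field `K`:
there are `s`-valuations `ν₁, …, ν_r` and natural numbers `a₁, …, a_r` with
`Iₘ = I(ν₁)_{m a₁} ∩ ⋯ ∩ I(ν_r)_{m a_r}` for all `m`. -/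
def IdealFiltration.IsSDivisorial {R : Type*} [CommRing R] (F : IdealFiltration R)
    (K : Type*) [Field K] [Algebra R K] (s : ℕ) : Prop :=
  ∃ (r : ℕ) (ν : Fin r → ValuationOver R K) (a : Fin r → ℕ),
    (∀ i, (ν i).IsSValuation s) ∧
      ∀ m, F.ideal m = ⨅ i, (ν i).valuationIdeal (m * a i)

/-! If `I₁ ⊄ Q`, the localized filtration is trivial and its spread is at most `1 < 2`. Otherwise,
all centers `𝔭` have `dim R/𝔭 = s`, so a `Q` not minimal over `I₁` lies in no center with `aᵢ ≠ 0`.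
Prime avoidance gives `x ∈ Q` outside them all, a nonzerodivisor modulo every `Iₙ`
(`exists_mem_forall_mul_mem`).

Now let `A = R_Q`, with maximal ideal `m`. The Rees ring need not be Noetherian, so a chain of `l +
1` primes in its fibre over `m` is pulled back to `A[X₁, …, X_l]` along elements separating
consecutive primes. The fibre there has dimension `l`, so the chain starts at `mA[X]`, of height at
most `ht m`. Since `x` lies in the first prime, some minimal prime `q` of `x` has `ker (A[X] →
(A/q)[t]) ⊆ mA[X]`. That kernel has height at least `ht q + l - 1 ≥ l`, because `(A/q)[t]` has
transcendence degree one over `A/q`. One more unit of height comes from strict inclusion if `q ≠ m`,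
and from the image being `A/m` if `q = m`. Hence `l + 1 ≤ ht m` (`length_add_one_le`). -/

/-- `z` is a root of a polynomial over `T` whose image under `ψ : T → L` is nonzero. -/
def RingHom.AlgebraicAt {T L : Type*} [CommRing T] [CommRing L] (ψ : T →+* L) (z : L) : Prop :=
  ∃ p : T[X], p.map ψ ≠ 0 ∧ p.eval₂ ψ z = 0

namespace RingHom.AlgebraicAt

variable {T T' L : Type*} [CommRing T] [CommRing T'] [CommRing L]

theorem of_comp {f : T →+* T'} {χ : T' →+* L} {z : L} (h : (χ.comp f).AlgebraicAt z) :
    χ.AlgebraicAt z := by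
  obtain ⟨p, hp, hz⟩ := h
  exact ⟨p.map f, by rwa [Polynomial.map_map], by rwa [Polynomial.eval₂_map]⟩

theorem of_isAlgebraic {S : Type*} [CommRing S] [Algebra S L] {ψ : T →+* L} {z : L}
    (hinj : Function.Injective (algebraMap S L))
    (hS : ∀ s : S, algebraMap S L s ∈ ψ.range) (hz : IsAlgebraic S z) : ψ.AlgebraicAt z := by
  obtain ⟨p, hp, hpz⟩ := hz
  have hlift : p.map (algebraMap S L) ∈ Polynomial.lifts ψ := by
    rw [Polynomial.lifts_iff_coeff_lifts]
    intro n
    rw [Polynomial.coeff_map]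
    exact hS _
  obtain ⟨p', hp'⟩ := (Polynomial.mem_lifts _).1 hlift
  refine ⟨p', ?_, ?_⟩
  · rw [hp']
    exact (Polynomial.map_ne_zero_iff hinj).2 hp
  · rw [Polynomial.eval₂_eq_eval_map, hp', ← Polynomial.eval₂_eq_eval_map]
    exact hpz

end RingHom.AlgebraicAt

/-! ### Heights of kernels of evaluation maps on polynomial rings. -/

/-- A flat (e.g. polynomial) extension does not decrease heights of primes lying over. -/
theorem Ideal.height_le_height_of_liesOver_of_hasGoingDown {T S : Type*} [CommRing T] [CommRing S]
    [IsNoetherianRing T] [IsNoetherianRing S] [Algebra T S] [Algebra.HasGoingDown T S]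
    (p : Ideal T) [p.IsPrime] (P : Ideal S) [P.IsPrime] [P.LiesOver p] : p.height ≤ P.height := by
  rw [Ideal.height_eq_height_add_of_liesOver_of_hasGoingDown p P]
  exact le_self_add

theorem RingHom.height_ker_le_height_ker_eval₂RingHom {T L : Type*} [CommRing T]
    [IsNoetherianRing T] [CommRing L] [IsDomain L] (ψ : T →+* L) (z : L) :
    (RingHom.ker ψ).height ≤ (RingHom.ker (Polynomial.eval₂RingHom ψ z)).height := by
  have : (RingHom.ker ψ).IsPrime := RingHom.ker_isPrime ψ
  have : (RingHom.ker (Polynomial.eval₂RingHom ψ z)).IsPrime := RingHom.ker_isPrime _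
  have : (RingHom.ker (Polynomial.eval₂RingHom ψ z)).LiesOver (RingHom.ker ψ) :=
    ⟨by ext a; simp [RingHom.mem_ker, Ideal.under]⟩
  exact Ideal.height_le_height_of_liesOver_of_hasGoingDown _ _

/-- The extension of `ker ψ` to `T[X]` is a prime over `ker ψ`; an algebraic relation for `z` lies
in the evaluation kernel but not in this extension. -/
theorem RingHom.AlgebraicAt.height_ker_add_one_le {T L : Type*} [CommRing T]
    [IsNoetherianRing T] [CommRing L] [IsDomain L] {ψ : T →+* L} {z : L} (hz : ψ.AlgebraicAt z) :
    (RingHom.ker ψ).height + 1 ≤ (RingHom.ker (Polynomial.eval₂RingHom ψ z)).height := by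
  have : (RingHom.ker ψ).IsPrime := RingHom.ker_isPrime ψ
  have : (RingHom.ker (Polynomial.eval₂RingHom ψ z)).IsPrime := RingHom.ker_isPrime _
  have hprime : ((RingHom.ker ψ).map (Polynomial.C : T →+* T[X])).IsPrime :=
    Ideal.isPrime_map_C_of_isPrime
  have : ((RingHom.ker ψ).map (Polynomial.C : T →+* T[X])).LiesOver (RingHom.ker ψ) := ⟨by
    ext a
    rw [Ideal.mem_comap, Polynomial.algebraMap_eq, Ideal.mem_map_C_iff]
    refine ⟨fun h n => ?_, fun h => by simpa using h 0⟩
    rw [Polynomial.coeff_C]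
    split_ifs
    exacts [h, Ideal.zero_mem _]⟩
  refine le_trans ?_ (Ideal.height_add_one_le_of_lt_of_isPrime
    (I := (RingHom.ker ψ).map (Polynomial.C : T →+* T[X])) ?_)
  · gcongr
    exact Ideal.height_le_height_of_liesOver_of_hasGoingDown _ _
  · refine lt_of_le_of_ne ?_ ?_
    · rw [Ideal.map_le_iff_le_comap]
      intro a ha
      simpa [RingHom.mem_ker] using ha
    · intro h
      obtain ⟨p, hp, hpz⟩ := hz
      have hmem : p ∈ (RingHom.ker ψ).map (Polynomial.C : T →+* T[X]) := by
        rw [h]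
        exact hpz
      rw [Ideal.mem_map_C_iff] at hmem
      apply hp
      ext n
      simpa [RingHom.mem_ker] using hmem n

namespace MvPolynomial

variable {T L : Type*} [CommRing T] [CommRing L]

theorem eval₂Hom_eq_comp_finSuccEquiv (ψ : T →+* L) {n : ℕ} (x : Fin (n + 1) → L) :
    eval₂Hom ψ x = (Polynomial.eval₂RingHom (eval₂Hom ψ (Fin.tail x)) (x 0)).comp
      (finSuccEquiv T n).toRingEquiv.toRingHom := by
  refine MvPolynomial.ringHom_ext (fun a => ?_) (fun i => ?_)
  · simp [finSuccEquiv_apply]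
  · refine Fin.cases ?_ (fun j => ?_) i
    · simp [finSuccEquiv_apply]
    · simp [finSuccEquiv_apply, Fin.tail]

theorem height_ker_eval₂Hom_succ (ψ : T →+* L) {n : ℕ} (x : Fin (n + 1) → L) :
    (RingHom.ker (eval₂Hom ψ x)).height =
      (RingHom.ker (Polynomial.eval₂RingHom (eval₂Hom ψ (Fin.tail x)) (x 0))).height := by
  rw [eval₂Hom_eq_comp_finSuccEquiv, ← RingHom.comap_ker]
  exact RingEquiv.height_comap (finSuccEquiv T n).toRingEquiv _

theorem eval₂Hom_comp_C' (ψ : T →+* L) {ι : Type*} (x : ι → L) :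
    (eval₂Hom ψ x).comp C = ψ := by
  ext; simp

variable [IsNoetherianRing T] [IsDomain L]

theorem height_ker_add_le_of_algebraicAt (ψ : T →+* L) {n : ℕ} (x : Fin n → L)
    (hx : ∀ i, ψ.AlgebraicAt (x i)) :
    (RingHom.ker ψ).height + n ≤ (RingHom.ker (eval₂Hom ψ x)).height := by
  induction n with
  | zero =>
    have : RingHom.ker (eval₂Hom ψ x) =
        (RingHom.ker ψ).comap (isEmptyRingEquiv T (Fin 0)) := by
      ext f
      obtain ⟨a, rfl⟩ := C_surjective (R := T) (Fin 0) f
      rw [Ideal.mem_comap, RingHom.mem_ker, RingHom.mem_ker, coe_eval₂Hom, eval₂_C]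
      exact iff_of_eq (congrArg (ψ · = 0) ((isEmptyAlgEquiv T (Fin 0)).commutes a).symm)
    rw [this, RingEquiv.height_comap]
    simp
  | succ n ih =>
    rw [height_ker_eval₂Hom_succ]
    have h0 : (eval₂Hom ψ (Fin.tail x)).AlgebraicAt (x 0) := by
      refine RingHom.AlgebraicAt.of_comp (f := C) ?_
      rw [eval₂Hom_comp_C']
      exact hx 0
    refine le_trans ?_ h0.height_ker_add_one_le
    push_cast
    rw [← add_assoc]
    gcongr
    exact ih (Fin.tail x) fun i => hx _

/-- If `L` has transcendence degree at most one over the image of `T`, then the kernel of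
`T[X₁, …, Xₙ] → L` has height at least `n - 1` more than the kernel of `T → L`. -/
theorem height_ker_add_le_add_one (ψ : T →+* L)
    (hψ : ∀ y z : L, ¬ ψ.AlgebraicAt y → (Polynomial.eval₂RingHom ψ y).AlgebraicAt z)
    {n : ℕ} (x : Fin n → L) :
    (RingHom.ker ψ).height + n ≤ (RingHom.ker (eval₂Hom ψ x)).height + 1 := by
  induction n with
  | zero =>
    exact (height_ker_add_le_of_algebraicAt ψ x fun i => i.elim0).trans le_self_add
  | succ n ih =>
    rw [height_ker_eval₂Hom_succ]
    -- If `x 0` is not algebraic over the other entries, `hψ` forces each of those to be algebraic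
    -- over `T`, so the single loss of height occurs at `x 0`.
    by_cases h0 : (eval₂Hom ψ (Fin.tail x)).AlgebraicAt (x 0)
    · refine le_trans ?_ (add_le_add_left h0.height_ker_add_one_le 1)
      push_cast
      rw [← add_assoc]
      exact add_le_add (ih _) le_rfl
    · have hall : ∀ i, ψ.AlgebraicAt (Fin.tail x i) := by
        intro i
        by_contra hi
        apply h0
        have hcomp : (eval₂Hom ψ (Fin.tail x)).comp (Polynomial.eval₂RingHom C (X i)) =
            Polynomial.eval₂RingHom ψ (Fin.tail x i) := by
          ext <;> simp
        refine RingHom.AlgebraicAt.of_comp (f := Polynomial.eval₂RingHom C (X i)) ?_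
        rw [hcomp]
        exact hψ _ _ hi
      push_cast
      rw [← add_assoc]
      gcongr
      exact (height_ker_add_le_of_algebraicAt ψ _ hall).trans
        (RingHom.height_ker_le_height_ker_eval₂RingHom _ _)

end MvPolynomial

/-- `D[X]` has transcendence degree one over `D`, so a transcendental `y` is already a transcendence
basis. -/
theorem Polynomial.algebraicAt_eval₂RingHom_C_comp {A D : Type*} [CommRing A] [CommRing D]
    [IsDomain D] {f : A →+* D} (hf : Function.Surjective f) {y : D[X]}
    (hy : ¬ ((C : D →+* D[X]).comp f).AlgebraicAt y) (z : D[X]) :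
    (eval₂RingHom ((C : D →+* D[X]).comp f) y).AlgebraicAt z := by
  have htr : Transcendental D y := fun h => hy <|
    RingHom.AlgebraicAt.of_isAlgebraic C_injective
      (fun s => by obtain ⟨a, rfl⟩ := hf s; exact ⟨a, rfl⟩) h
  have hind : AlgebraicIndependent D ![y] := by
    rwa [algebraicIndependent_unique_type_iff]
  have hbasis : IsTranscendenceBasis D ![y] :=
    hind.isTranscendenceBasis_of_lift_trdeg_le_of_finite (by simp)
  have halg := hbasis.isAlgebraic
  refine RingHom.AlgebraicAt.of_isAlgebraic (S := Algebra.adjoin D (Set.range ![y]))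
    Subtype.val_injective (fun s => ?_) (halg.isAlgebraic z)
  have hs : (s : D[X]) ∈ Algebra.adjoin D {y} := by
    have := s.2
    simpa using this
  rw [Algebra.adjoin_singleton_eq_range_aeval] at hs
  obtain ⟨p, hp⟩ := hs
  obtain ⟨p', rfl⟩ := Polynomial.map_surjective f hf p
  refine ⟨p', ?_⟩
  change _ = (s : D[X])
  rw [← hp]
  simp [aeval_def, eval₂_map]

/-! ### The fibre of a polynomial ring over a maximal ideal. -/

namespace MvPolynomial

variable {A : Type*} [CommRing A] {ι : Type*}

theorem isPrime_map_C (m : Ideal A) [m.IsPrime] :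
    (m.map (C : A →+* MvPolynomial ι A)).IsPrime := by
  rw [← Ideal.Quotient.isDomain_iff_prime]
  exact (quotientEquivQuotientMvPolynomial (σ := ι) m).symm.toMulEquiv.isDomain

theorem height_map_C_le [IsNoetherianRing A] [Finite ι] (m : Ideal A) [m.IsPrime] :
    (m.map (C : A →+* MvPolynomial ι A)).height ≤ m.height := by
  have := isPrime_map_C (ι := ι) m
  have : (m.map (C : A →+* MvPolynomial ι A)).LiesOver m := ⟨by
    ext a
    rw [Ideal.mem_comap, algebraMap_eq, mem_map_C_iff]
    refine ⟨fun h n => ?_, fun h => by simpa using h 0⟩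
    classical
    rw [coeff_C]
    split_ifs
    exacts [h, Ideal.zero_mem _]⟩
  refine (Ideal.height_le_height_add_of_liesOver m (m.map (C : A →+* MvPolynomial ι A))).trans ?_
  rw [algebraMap_eq, Ideal.map_quotient_self, Ideal.height_bot, add_zero]

/-- Otherwise prepending the prime `mA[X]` gives a chain too long for the polynomial ring over the
field `A/m`. -/
theorem head_eq_map_C_of_ltSeries [Finite ι] (m : Ideal A) [m.IsMaximal]
    (l : LTSeries (PrimeSpectrum (MvPolynomial ι A))) (hl : Nat.card ι ≤ l.length)
    (hm : m.map C ≤ l.head.asIdeal) : l.head.asIdeal = m.map C := by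
  by_contra hne
  have hprime := isPrime_map_C (ι := ι) m
  have hlt : (⟨m.map C, hprime⟩ : PrimeSpectrum (MvPolynomial ι A)) < l.head :=
    lt_of_le_of_ne hm fun h => hne (congrArg PrimeSpectrum.asIdeal h).symm
  let l' := l.cons _ hlt
  have hmem : ∀ i, l' i ∈ PrimeSpectrum.zeroLocus ((m.map C : Ideal (MvPolynomial ι A)) : Set _) := by
    intro i
    have h0 : l'.head ≤ l' i := LTSeries.head_le l' i
    rw [RelSeries.head_cons] at h0
    exact h0
  let l'' : LTSeries (PrimeSpectrum.zeroLocus ((m.map C : Ideal (MvPolynomial ι A)) : Set _)) :=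
    { length := l'.length
      toFun := fun i => ⟨l' i, hmem i⟩
      step := fun i => l'.step i }
  have h1 : (l''.length : WithBot ℕ∞) ≤ ringKrullDim (MvPolynomial ι A ⧸ m.map C) := by
    rw [ringKrullDim_quotient]
    exact Order.LTSeries.length_le_krullDim l''
  let := Ideal.Quotient.field m
  rw [← ringKrullDim_eq_of_ringEquiv (quotientEquivQuotientMvPolynomial (σ := ι) m).toRingEquiv,
    ringKrullDim_of_isNoetherianRing, ringKrullDim_eq_zero_of_field, zero_add] at h1
  have h2 : l''.length ≤ Nat.card ι := by exact_mod_cast h1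
  have h3 : l''.length = l.length + 1 := l.cons_length _ hlt
  omega

end MvPolynomial

/-! ### Chains of primes in the Rees ring and the bound on the analytic spread. -/

namespace IdealFiltration

variable {A : Type*} [CommRing A]

theorem exists_eq_algebraMap_mul_of_dvd_coeff (G : IdealFiltration A) {x : A}
    (hx : ∀ n a, x * a ∈ G.ideal n → a ∈ G.ideal n) {g : G.rees}
    (hg : ∀ n, x ∣ (g : A[X]).coeff n) : ∃ h : G.rees, g = algebraMap A G.rees x * h := by
  obtain ⟨h, hh⟩ := (Polynomial.C_dvd_iff_dvd_coeff x (g : A[X])).2 hg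
  refine ⟨⟨h, fun n => hx n _ ?_⟩, Subtype.ext hh⟩
  rw [← Polynomial.coeff_C_mul, ← hh]
  exact g.2 n

/-- If `x` is a nonzerodivisor modulo every ideal of the filtration, then for a map `Φ` to the Rees
ring, some minimal prime `q` of `x` is such that `ker (B → (A ⧸ q)[t])` lies in the preimage of a
given prime of the Rees ring containing `x`. -/
theorem exists_minimalPrimes_ker_le [IsNoetherianRing A] (G : IdealFiltration A) {x : A}
    (hx : ∀ n a, x * a ∈ G.ideal n → a ∈ G.ideal n) {B : Type*} [CommRing B]
    (Φ : B →+* G.rees) (P : Ideal G.rees) [P.IsPrime] (hxP : algebraMap A G.rees x ∈ P) :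
    ∃ q ∈ (Ideal.span {x}).minimalPrimes,
      RingHom.ker (((Polynomial.mapRingHom (Ideal.Quotient.mk q)).comp
        G.rees.val.toRingHom).comp Φ) ≤ P.comap Φ := by
  have hfin := Ideal.finite_minimalPrimes_of_isNoetherianRing A (Ideal.span {x})
  have hprime : (P.comap Φ).IsPrime := inferInstance
  suffices h : hfin.toFinset.inf (fun q => RingHom.ker
      (((Polynomial.mapRingHom (Ideal.Quotient.mk q)).comp G.rees.val.toRingHom).comp Φ)) ≤
      P.comap Φ by
    obtain ⟨q, hq, hle⟩ := hprime.inf_le'.1 h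
    exact ⟨q, hfin.mem_toFinset.1 hq, hle⟩
  -- If all these kernels contain `f`, the coefficients of `Φ f` lie in the radical of `(x)`. Some
  -- power of `Φ f` is then divisible by `x` in `A[t]`, hence in the Rees ring, and so lies in `P`.
  intro f hf
  rw [Submodule.mem_finsetInf] at hf
  have hnil : IsNilpotent ((Φ f : A[X]).map (Ideal.Quotient.mk (Ideal.span {x}))) := by
    rw [Polynomial.isNilpotent_iff]
    intro n
    rw [Polynomial.coeff_map]
    have hrad : (Φ f : A[X]).coeff n ∈ (Ideal.span {x}).radical := by
      rw [← Ideal.sInf_minimalPrimes, Ideal.mem_sInf]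
      intro q hq
      have h1 := hf q (hfin.mem_toFinset.2 hq)
      rw [RingHom.mem_ker] at h1
      have h2 := congrArg (fun p => Polynomial.coeff p n) h1
      simpa [Ideal.Quotient.eq_zero_iff_mem] using h2
    obtain ⟨k, hk⟩ := hrad
    exact ⟨k, by rw [← map_pow, Ideal.Quotient.eq_zero_iff_mem]; exact hk⟩
  obtain ⟨k, hk⟩ := hnil
  obtain ⟨h, hh⟩ := G.exists_eq_algebraMap_mul_of_dvd_coeff hx (g := Φ f ^ k) fun n => by
    rw [← Ideal.mem_span_singleton, ← Ideal.Quotient.eq_zero_iff_mem, ← Polynomial.coeff_map]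
    simp [hk]
  have hmem : Φ f ^ k ∈ P := by
    rw [hh]
    exact P.mul_mem_right _ hxP
  exact hprime.mem_of_pow_mem k (by rwa [Ideal.mem_comap, map_pow])

variable [IsDomain A] [IsLocalRing A] [IsNoetherianRing A]

open IsLocalRing in
/-- A chain of primes of the Rees ring modulo `m` has length less than the height of `m`, when some
nonzero `x` in `m` is a nonzerodivisor modulo every ideal of the filtration. -/
theorem length_add_one_le (G : IdealFiltration A) (hG : G.ideal 1 ≤ maximalIdeal A) {x : A}
    (hxm : x ∈ maximalIdeal A) (hx0 : x ≠ 0) (hx : ∀ n a, x * a ∈ G.ideal n → a ∈ G.ideal n)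
    (J : Ideal G.rees) (hJ : (maximalIdeal A).map (algebraMap A G.rees) ≤ J)
    (l : LTSeries (PrimeSpectrum (G.rees ⧸ J))) :
    (l.length + 1 : ℕ∞) ≤ (maximalIdeal A).height := by
  have hy : ∀ i : Fin l.length, ∃ u : G.rees,
      Ideal.Quotient.mk J u ∈ (l i.succ).asIdeal ∧
        Ideal.Quotient.mk J u ∉ (l i.castSucc).asIdeal := by
    intro i
    obtain ⟨y, hy1, hy2⟩ := SetLike.exists_of_lt
      (show (l i.castSucc).asIdeal < (l i.succ).asIdeal from l.step i)
    obtain ⟨u, rfl⟩ := Ideal.Quotient.mk_surjective y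
    exact ⟨u, hy1, hy2⟩
  choose u hu1 hu2 using hy
  let Φ : MvPolynomial (Fin l.length) A →+* G.rees :=
    MvPolynomial.eval₂Hom (algebraMap A G.rees) u
  let χ := (Ideal.Quotient.mk J).comp Φ
  let l' : LTSeries (PrimeSpectrum (MvPolynomial (Fin l.length) A)) :=
    { length := l.length
      toFun := fun i => PrimeSpectrum.comap χ (l i)
      step := fun i => by
        refine SetLike.lt_iff_le_and_exists.2
          ⟨Ideal.comap_mono (l.step i).le, MvPolynomial.X i, ?_, ?_⟩
        · simpa [χ, Φ] using hu1 i
        · simpa [χ, Φ] using hu2 i }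
  let P : Ideal G.rees := l.head.asIdeal.comap (Ideal.Quotient.mk J)
  have hJP : J ≤ P := fun a ha => by
    rw [Ideal.mem_comap, Ideal.Quotient.eq_zero_iff_mem.2 ha]
    exact Ideal.zero_mem _
  have hmP : ∀ a ∈ maximalIdeal A, algebraMap A G.rees a ∈ P :=
    fun a ha => hJP (hJ (Ideal.mem_map_of_mem _ ha))
  have hhead : P.comap Φ = (maximalIdeal A).map MvPolynomial.C := by
    refine MvPolynomial.head_eq_map_C_of_ltSeries (maximalIdeal A) l' (by simp [l']) ?_
    rw [Ideal.map_le_iff_le_comap]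
    intro a ha
    have := hmP a ha
    simpa [P, l', χ, Φ, RelSeries.head] using this
  obtain ⟨q, hq, hle⟩ := G.exists_minimalPrimes_ker_le hx Φ P (hmP x hxm)
  rw [hhead] at hle
  have hqprime : q.IsPrime := hq.1.1
  let v : Fin l.length → (A ⧸ q)[X] := fun i => (u i : A[X]).map (Ideal.Quotient.mk q)
  let ψ : A →+* (A ⧸ q)[X] := Polynomial.C.comp (Ideal.Quotient.mk q)
  have hcomp : ((Polynomial.mapRingHom (Ideal.Quotient.mk q)).comp
        G.rees.val.toRingHom).comp Φ = MvPolynomial.eval₂Hom ψ v := by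
    refine MvPolynomial.ringHom_ext (fun a => ?_) (fun i => ?_)
    · simp [Φ, ψ]
    · simp [Φ, v]
  rw [hcomp] at hle
  have hker : RingHom.ker ψ = q := by
    ext a
    simp [ψ, RingHom.mem_ker, Ideal.Quotient.eq_zero_iff_mem]
  have hht : 1 ≤ (RingHom.ker ψ).height := by
    rw [hker, Order.one_le_iff_ne_zero, Ne, Ideal.height_eq_zero_iff_eq_bot]
    rintro rfl
    exact hx0 (hq.1.2 (Ideal.mem_span_singleton_self x))
  refine le_trans ?_ (MvPolynomial.height_map_C_le (ι := Fin l.length) (maximalIdeal A))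
  by_cases hqm : q = maximalIdeal A
  · refine le_trans ?_ (Ideal.height_mono hle)
    have halg : ∀ i, ψ.AlgebraicAt (v i) := by
      intro i
      -- Coefficients of positive degree lie in `I₁ ⊆ m = q`, so only the constant term survives.
      have hv : v i = ψ ((u i : A[X]).coeff 0) := by
        ext n
        simp only [v, ψ, RingHom.comp_apply, Polynomial.coeff_map, Polynomial.coeff_C]
        split_ifs with h
        · rw [h]
        · rw [Ideal.Quotient.eq_zero_iff_mem, hqm]
          exact hG (G.antitone_ideal (Nat.one_le_iff_ne_zero.2 h) ((u i).2 n))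
      refine ⟨Polynomial.X - Polynomial.C ((u i : A[X]).coeff 0), ?_, ?_⟩
      · rw [Polynomial.map_sub, Polynomial.map_X, Polynomial.map_C]
        exact Polynomial.X_sub_C_ne_zero _
      · simp [hv]
    refine le_trans ?_ (MvPolynomial.height_ker_add_le_of_algebraicAt ψ v halg)
    rw [add_comm]
    gcongr
  · have : (RingHom.ker (MvPolynomial.eval₂Hom ψ v)).IsPrime := RingHom.ker_isPrime _
    have := MvPolynomial.isPrime_map_C (ι := Fin l.length) (maximalIdeal A)
    have hlt : RingHom.ker (MvPolynomial.eval₂Hom ψ v) < (maximalIdeal A).map MvPolynomial.C := by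
      refine lt_of_le_of_ne hle fun heq => hqm ?_
      refine le_antisymm (le_maximalIdeal hqprime.ne_top) fun a ha => ?_
      have hmem : MvPolynomial.C a ∈ RingHom.ker (MvPolynomial.eval₂Hom ψ v) := by
        rw [heq]
        exact Ideal.mem_map_of_mem _ ha
      rw [← hker]
      simpa [RingHom.mem_ker] using hmem
    refine le_trans ?_ (Ideal.height_add_one_le_of_lt_of_isPrime hlt)
    refine le_trans ?_ (MvPolynomial.height_ker_add_le_add_one ψ (fun y z hy =>
      Polynomial.algebraicAt_eval₂RingHom_C_comp Ideal.Quotient.mk_surjective hy z) v)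
    rw [add_comm]
    gcongr

open IsLocalRing in
/-- If some nonzero `x` in the maximal ideal is a nonzerodivisor modulo every ideal of the
filtration, then the analytic spread is less than the dimension. -/
theorem analyticSpread_lt_ringKrullDim (G : IdealFiltration A)
    (hG : G.ideal 1 ≤ maximalIdeal A) {x : A} (hxm : x ∈ maximalIdeal A) (hx0 : x ≠ 0)
    (hx : ∀ n a, x * a ∈ G.ideal n → a ∈ G.ideal n) :
    G.analyticSpread < ringKrullDim A := by
  rw [← maximalIdeal_height_eq_ringKrullDim]
  have hne : (maximalIdeal A).height ≠ ⊤ := Ideal.height_ne_top (Ideal.IsPrime.ne_top inferInstance)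
  obtain ⟨d, hd⟩ := ENat.ne_top_iff_exists.1 hne
  have hpos : d ≠ 0 := by
    rintro rfl
    have h0 : (maximalIdeal A).height = 0 := by rw [← hd]; rfl
    rw [Ideal.height_eq_zero_iff_eq_bot] at h0
    exact hx0 (by simpa [h0] using hxm)
  obtain ⟨d, rfl⟩ := Nat.exists_eq_succ_of_ne_zero hpos
  refine lt_of_le_of_lt (b := ((d : ℕ∞) : WithBot ℕ∞)) (iSup_le fun l => ?_) ?_
  · have h := G.length_add_one_le hG hxm hx0 hx _ le_rfl l
    rw [← hd] at h
    have h' : l.length + 1 ≤ d + 1 := by exact_mod_cast h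
    exact_mod_cast Nat.le_of_succ_le_succ h'
  · rw [← hd]
    exact_mod_cast Nat.lt_succ_self d

/-- The analytic spread of the trivial filtration is at most one. -/
theorem analyticSpread_le_one_of_forall_eq_top {A : Type*} [CommRing A] [IsLocalRing A]
    (G : IdealFiltration A) (hG : ∀ n, G.ideal n = ⊤) : G.analyticSpread ≤ 1 := by
  let m := IsLocalRing.maximalIdeal A
  let incl : A[X] →+* G.rees := (RingHom.id A[X]).codRestrict G.rees.toSubring
    fun f i => by simp [hG]
  let f := (Ideal.Quotient.mk (m.map (algebraMap A G.rees))).comp incl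
  have hf : Function.Surjective f :=
    Ideal.Quotient.mk_surjective.comp fun g => ⟨g, Subtype.ext rfl⟩
  have hker : ∀ a ∈ m.map (Polynomial.C : A →+* A[X]), f a = 0 := by
    have : m.map (Polynomial.C : A →+* A[X]) ≤ RingHom.ker f := by
      rw [Ideal.map_le_iff_le_comap]
      intro a ha
      rw [Ideal.mem_comap, RingHom.mem_ker]
      exact Ideal.Quotient.eq_zero_iff_mem.2 (Ideal.mem_map_of_mem (algebraMap A G.rees) ha)
    exact this
  let := Ideal.Quotient.field m
  refine (ringKrullDim_le_of_surjective (Ideal.Quotient.lift _ f hker)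
    (Ideal.Quotient.lift_surjective_of_surjective _ hker hf)).trans ?_
  rw [← ringKrullDim_eq_of_ringEquiv (Ideal.polynomialQuotientEquivQuotientPolynomial m),
    Polynomial.ringKrullDim_of_isNoetherianRing, ringKrullDim_eq_zero_of_field, zero_add]

end IdealFiltration

/-! ### Centers of valuations and the choice of `x`. -/

/-- Killing a nonzero element of the domain `R/p` lowers its finite dimension. -/
theorem Ideal.eq_of_le_of_ringKrullDim_quotient_eq {R : Type*} [CommRing R] {p q : Ideal R}
    [p.IsPrime] (hpq : p ≤ q) {s : ℕ} (hp : ringKrullDim (R ⧸ p) = s)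
    (hq : ringKrullDim (R ⧸ q) = s) : p = q := by
  by_contra hne
  obtain ⟨a, haq, hap⟩ := SetLike.exists_of_lt (lt_of_le_of_ne hpq hne)
  have h := ringKrullDim_succ_le_of_surjective (Ideal.Quotient.factor hpq)
    (Ideal.Quotient.factor_surjective hpq) (r := Ideal.Quotient.mk p a)
    (mem_nonZeroDivisors_of_ne_zero fun h => hap (Ideal.Quotient.eq_zero_iff_mem.1 h))
    (by rw [Ideal.Quotient.factor_mk]; exact Ideal.Quotient.eq_zero_iff_mem.2 haq)
  rw [hp, hq] at h
  have h' : s + 1 ≤ s := by exact_mod_cast h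
  omega

namespace ValuationOver

variable {R K : Type*} [CommRing R] [Field K] [Algebra R K] (ν : ValuationOver R K)

theorem center_pow_le_valuationIdeal (n : ℕ) : ν.center ^ n ≤ ν.valuationIdeal n :=
  Ideal.le_comap_pow _ n

theorem valuationIdeal_zero : ν.valuationIdeal 0 = ⊤ := by
  simp [valuationIdeal]

theorem mem_valuationIdeal_of_mul_mem {x b : R} (hx : x ∉ ν.center) {n : ℕ}
    (h : x * b ∈ ν.valuationIdeal n) : b ∈ ν.valuationIdeal n := by
  have hunit : IsUnit (ν.toRing x) := by
    by_contra hu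
    exact hx ((IsLocalRing.mem_maximalIdeal _).2 hu)
  rw [valuationIdeal, Ideal.mem_comap, map_mul] at h
  exact (Ideal.unit_mul_mem_iff_mem _ hunit).1 h

end ValuationOver

namespace IdealFiltration

variable {R : Type*} [CommRing R]

theorem localize_mem_of_mul_mem (F : IdealFiltration R) (Q : Ideal R) [Q.IsPrime] {x : R}
    (hx : ∀ n a, x * a ∈ F.ideal n → a ∈ F.ideal n) (n : ℕ) (a : Localization.AtPrime Q)
    (ha : algebraMap R _ x * a ∈ (F.localize Q).ideal n) : a ∈ (F.localize Q).ideal n := by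
  obtain ⟨b, s, rfl⟩ := IsLocalization.exists_mk'_eq Q.primeCompl a
  change _ ∈ (F.ideal n).map _ at ha
  change _ ∈ (F.ideal n).map _
  rw [IsLocalization.mul_mk'_eq_mk'_of_mul, IsLocalization.mk'_mem_map_algebraMap_iff] at ha
  rw [IsLocalization.mk'_mem_map_algebraMap_iff]
  obtain ⟨u, hu, h⟩ := ha
  exact ⟨u, hu, hx n _ (by rwa [mul_left_comm])⟩

theorem localize_ideal_eq_top (F : IdealFiltration R) {Q : Ideal R} [Q.IsPrime]
    (hQ : ¬ F.ideal 1 ≤ Q) (n : ℕ) : (F.localize Q).ideal n = ⊤ := by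
  obtain ⟨b, hb, hbQ⟩ := SetLike.not_le_iff_exists.1 hQ
  have hpow : ∀ n, b ^ n ∈ F.ideal n := by
    intro n
    induction n with
    | zero => simp [F.ideal_zero]
    | succ n ih =>
      rw [pow_succ]
      exact F.mul_le n 1 (Ideal.mul_mem_mul ih hb)
  refine Ideal.eq_top_of_isUnit_mem _ (Ideal.mem_map_of_mem _ (hpow n)) ?_
  exact IsLocalization.map_units (Localization.AtPrime Q)
    (⟨b ^ n, fun h => hbQ (Ideal.IsPrime.mem_of_pow_mem ‹_› n h)⟩ : Q.primeCompl)

/-- A prime containing `I₁` but not minimal over it contains a nonzero element which is a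
nonzerodivisor modulo every ideal of the `s`-divisorial filtration. -/
theorem IsSDivisorial.exists_mem_forall_mul_mem {K : Type*} [Field K] [Algebra R K]
    {F : IdealFiltration R} {s : ℕ} (hF : F.IsSDivisorial K s) {Q : Ideal R} [Q.IsPrime]
    (hle : F.ideal 1 ≤ Q) (hQmin : Q ∉ (F.ideal 1).minimalPrimes) :
    ∃ x ∈ Q, x ≠ 0 ∧ ∀ n a, x * a ∈ F.ideal n → a ∈ F.ideal n := by
  obtain ⟨r, ν, a, hν, hF⟩ := hF
  have hcenter : ∀ P : Ideal R, P.IsPrime → F.ideal 1 ≤ P → ∃ i, a i ≠ 0 ∧ (ν i).center ≤ P := by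
    intro P hP hP1
    rw [hF 1, ← Finset.inf_univ_eq_iInf] at hP1
    obtain ⟨i, -, hi⟩ := hP.inf_le'.1 hP1
    rw [one_mul] at hi
    have hai : a i ≠ 0 := by
      intro h0
      rw [h0, ValuationOver.valuationIdeal_zero, top_le_iff] at hi
      exact hP.ne_top hi
    exact ⟨i, hai, hP.le_of_pow_le (((ν i).center_pow_le_valuationIdeal _).trans hi)⟩
  have hnot : ∀ i, a i ≠ 0 → ¬ Q ≤ (ν i).center := by
    intro i _ hi
    -- Such a `P` contains a center; if `Q` lay in another center, the equality of dimensions would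
    -- make the two centers equal, squeezing `P` and `Q` together.
    have key : ∀ P : Ideal R, P.IsPrime → F.ideal 1 ≤ P → P ≤ Q → Q ≤ P := by
      intro P hP hP1 hPQ
      obtain ⟨j, -, hj⟩ := hcenter P hP hP1
      have := Ideal.eq_of_le_of_ringKrullDim_quotient_eq ((hj.trans hPQ).trans hi)
        (hν j).2 (hν i).2
      exact hi.trans (this ▸ hj)
    exact hQmin ⟨⟨‹_›, hle⟩, fun P hP hPQ => key P hP.1 hP.2 hPQ⟩
  obtain ⟨j, hj, -⟩ := hcenter Q ‹_› hle
  -- Indices with `a i = 0` contribute only unit ideals and need not be avoided; the index `j` with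
  -- `a j ≠ 0` ensures `x ≠ 0`.
  have havoid : ¬ ((Q : Set R) ⊆ ⋃ i ∈ {i | a i ≠ 0}, ((ν i).center : Set R)) := by
    rw [Ideal.subset_union_prime_finite (Set.toFinite _) j j fun i _ _ _ => inferInstance]
    rintro ⟨i, hi, h⟩
    exact hnot i hi h
  obtain ⟨x, hxQ, hx⟩ := Set.not_subset.1 havoid
  simp only [Set.mem_iUnion, not_exists] at hx
  refine ⟨x, hxQ, fun h0 => hx j hj (by simp [h0]), fun n b hb => ?_⟩
  rw [hF, Ideal.mem_iInf] at hb ⊢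
  intro i
  by_cases hi : a i = 0
  · simp [hi, ValuationOver.valuationIdeal_zero]
  · exact (ν i).mem_valuationIdeal_of_mul_mem (hx i hi) (hb i)

end IdealFiltration

theorem mainTheorem4 {R : Type*} [CommRing R] [IsDomain R] [IsLocalRing R] [IsNoetherianRing R]
    (K : Type*) [Field K] [Algebra R K] [IsFractionRing R K]
    (s : ℕ) (F : IdealFiltration R) (hF : F.IsSDivisorial K s)
    (Q : Ideal R) [Q.IsPrime] (hQmin : Q ∉ (F.ideal 1).minimalPrimes)
    (hQ : F.ideal 1 ≤ Q ∨ 2 ≤ ringKrullDim (Localization.AtPrime Q)) :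
    (F.localize Q).analyticSpread < ringKrullDim (Localization.AtPrime Q) := by
  by_cases hle : F.ideal 1 ≤ Q
  · obtain ⟨x, hxQ, hx0, hx⟩ := hF.exists_mem_forall_mul_mem hle hQmin
    have hinj : Function.Injective (algebraMap R (Localization.AtPrime Q)) :=
      IsLocalization.injective _ Q.primeCompl_le_nonZeroDivisors
    have : IsDomain (Localization.AtPrime Q) :=
      IsLocalization.isDomain_localization Q.primeCompl_le_nonZeroDivisors
    have : IsNoetherianRing (Localization.AtPrime Q) :=
      IsLocalization.isNoetherianRing Q.primeCompl _ inferInstance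
    have hmax := Localization.AtPrime.map_eq_maximalIdeal (I := Q)
    refine (F.localize Q).analyticSpread_lt_ringKrullDim (x := algebraMap R _ x) ?_ ?_ ?_
      (F.localize_mem_of_mul_mem Q hx)
    · rw [← hmax]
      exact Ideal.map_mono hle
    · rw [← hmax]
      exact Ideal.mem_map_of_mem _ hxQ
    · rwa [Ne, map_eq_zero_iff _ hinj]
  · refine ((F.localize Q).analyticSpread_le_one_of_forall_eq_top
      (F.localize_ideal_eq_top hle)).trans_lt (lt_of_lt_of_le ?_ (hQ.resolve_left hle))
    exact_mod_cast (one_lt_two : (1 : ℕ) < 2)
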